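/- A rational function $A\in\mathbb C(z)$ is regarded as a holomorphic map $A:\mathbb{CP}^1\to\mathbb{CP}^1$, and $A^{\circ k}$ denotes its $k$-th iterate. Let $G(A)$ be the group of Möbius transformations $\sigma\in\mathrm{Aut}(\mathbb{CP}^1)$ such that $A\circ\sigma=\nu_\sigma\circ A$ for some Möbius transformation $\nu_\sigma$ (which is then unique if $A$ is non-constant), and let $\widehat G(A)$ be the image of the homomorphism $\gamma_A:G(A)\to\mathrm{Aut}(\mathbb{CP}^1)$, $\sigma\mapsto\nu_\sigma$. Let $\Sigma(A)$ and $\mathrm{Aut}(A)$ be the subgroups of $G(A)$ consisting of those $\sigma$ with $A\circ\sigma=A$ and with $A\circ\sigma=\sigma\circ A$, respectively, and let $\Sigma_\infty(A)=\bigcup_{k=1}^\infty\Sigma(A^{\circ k})$, which is a group since $\Sigma(A^{\circ k})\subseteq\Sigma(A^{\circ(k+1)})$ for all $k\ge 1$. The function $A$ is called indecomposable if it is not a composition of two rational functions of degree at least two. **Theorem.** Let $A$ be an indecomposable rational function of degree at least two. 1. If the group $\widehat G(A)$ is trivial, then $\Sigma_\infty(A)=\Sigma(A)$. 2. In particular,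 if the group $G(A)$ is trivial, then the group $\Sigma_\infty(A)$ is trivial. 3. If $G(A)=\mathrm{Aut}(A)$, then the group $\Sigma_\infty(A)$ is trivial. -/

import Mathlib

open scoped IntermediateField

/-- Nonconstant rational functions `f ∈ ℂ(z)`, viewed as the nonconstant holomorphic self-maps
of `ℂℙ¹`. (Every rational function of degree at least one is of this kind.) -/
@[ext]
structure RatMap where
  /-- the underlying element of the field `ℂ(z)` -/
  fn : RatFunc ℂ
  /-- it is not a constant -/
  nonconst : ¬ ∃ c : ℂ, fn = RatFunc.C c

namespace RatMap

/-- The degree of a rational function: the maximum of the degrees of the numerator and the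
denominator in lowest terms. -/
noncomputable def degree (f : RatMap) : ℕ :=
  max f.fn.num.natDegree f.fn.denom.natDegree

theorem transcendental (f : RatMap) : Transcendental ℂ f.fn :=
  f.fn.transcendental_of_ne_C f.nonconst

/-- Substitution `f ↦ f ∘ g`, as an embedding of the field `ℂ(z)` into itself. -/
noncomputable def subst (g : RatMap) : RatFunc ℂ →ₐ[ℂ] RatFunc ℂ :=
  (ℂ⟮g.fn⟯.val).comp (RatFunc.algEquivOfTranscendental g.fn g.transcendental).toAlgHom

theorem subst_apply (g : RatMap) (f : RatFunc ℂ) :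
    g.subst f = RatFunc.eval RatFunc.C g.fn f := by
  simpa [subst, RatFunc.eval, Polynomial.aeval_def] using
    RatFunc.algEquivOfTranscendental_apply g.fn g.transcendental f

theorem subst_C (g : RatMap) (c : ℂ) : g.subst (RatFunc.C c) = RatFunc.C c := by
  rw [subst_apply, RatFunc.eval_C]

theorem subst_X (g : RatMap) : g.subst RatFunc.X = g.fn := by
  rw [subst_apply, RatFunc.eval_X]

theorem subst_injective (g : RatMap) : Function.Injective g.subst :=
  g.subst.toRingHom.injective

theorem mem_adjoin_iff (g : RatMap) (h : RatFunc ℂ) : h ∈ ℂ⟮g.fn⟯ ↔ ∃ f, g.subst f = h := by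
  constructor
  · intro hh
    obtain ⟨f, hf⟩ := (RatFunc.algEquivOfTranscendental g.fn g.transcendental).surjective ⟨h, hh⟩
    exact ⟨f, congrArg Subtype.val hf⟩
  · rintro ⟨f, rfl⟩
    exact ((RatFunc.algEquivOfTranscendental g.fn g.transcendental) f).2

/-- The composition `f ∘ g`: the quotient `p(g) / q(g)`, where `f = p / q` in lowest terms. -/
noncomputable def comp (f g : RatMap) : RatMap where
  fn := RatFunc.eval RatFunc.C g.fn f.fn
  nonconst := by
    rintro ⟨c, hc⟩
    rw [← subst_apply, ← subst_C g c] at hc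
    exact f.nonconst ⟨c, g.subst_injective hc⟩

theorem comp_fn (f g : RatMap) : (f.comp g).fn = g.subst f.fn := (subst_apply g f.fn).symm

theorem subst_comp (f g : RatMap) (h : RatFunc ℂ) :
    (f.comp g).subst h = g.subst (f.subst h) := by
  have hC : (g.subst : RatFunc ℂ →+* RatFunc ℂ).comp RatFunc.C = RatFunc.C :=
    RingHom.ext fun c => subst_C g c
  have hp (p : Polynomial ℂ) : g.subst (p.eval₂ RatFunc.C f.fn) =
      p.eval₂ RatFunc.C (f.comp g).fn := by
    have := Polynomial.hom_eval₂ p RatFunc.C (g.subst : RatFunc ℂ →+* RatFunc ℂ) f.fn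
    rw [hC] at this
    rw [comp_fn]
    exact this
  rw [subst_apply (f.comp g), subst_apply f, RatFunc.eval, RatFunc.eval, map_div₀, hp, hp]

/-- The identity map `z`. -/
noncomputable def ident : RatMap where
  fn := RatFunc.X
  nonconst := by
    rintro ⟨c, hc⟩
    have := congrArg (fun f => f.num.natDegree) hc
    simp at this

/-- Nonconstant rational functions form a monoid under composition. So `f * g` is `f ∘ g`, and
`f ^ k` is the `k`-th iterate of `f`. -/
noncomputable instance : Monoid RatMap where
  mul := comp
  one := ident
  mul_assoc f g h := RatMap.ext <| by
    change ((f.comp g).comp h).fn = (f.comp (g.comp h)).fn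
    rw [comp_fn, comp_fn, comp_fn, subst_comp]
  one_mul f := RatMap.ext <| by
    change (ident.comp f).fn = f.fn
    rw [comp_fn]
    exact subst_X f
  mul_one f := RatMap.ext <| by
    change (f.comp ident).fn = f.fn
    have h := subst_apply ident f.fn
    rw [comp_fn, h, RatFunc.eval]
    change Polynomial.eval₂ RatFunc.C RatFunc.X _ / Polynomial.eval₂ RatFunc.C RatFunc.X _ = _
    rw [← RatFunc.algebraMap_eq_C, ← Polynomial.aeval_def, ← Polynomial.aeval_def,
      RatFunc.aeval_X_left_eq_algebraMap, RatFunc.aeval_X_left_eq_algebraMap,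
      RatFunc.num_div_denom]

theorem mul_def (f g : RatMap) : f * g = f.comp g := rfl

theorem mul_right_cancel {f g h : RatMap} (e : f * h = g * h) : f = g :=
  RatMap.ext <| h.subst_injective <| by
    rw [← comp_fn, ← comp_fn, ← mul_def, ← mul_def, e]

/-- The rational functions that are invertible under composition are those of degree one. -/
theorem isUnit_iff_degree_eq_one (f : RatMap) : IsUnit f ↔ f.degree = 1 := by
  have key : f.degree = 1 ↔ RatFunc.X ∈ ℂ⟮f.fn⟯ := by
    rw [degree, ← RatFunc.finrank_eq_max_natDegree, IntermediateField.finrank_eq_one_iff_eq_top]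
    constructor
    · intro h
      rw [h]
      trivial
    · intro h
      rw [eq_top_iff, ← RatFunc.adjoin_X]
      exact IntermediateField.adjoin_simple_le_iff.mpr h
  rw [key, mem_adjoin_iff]
  constructor
  · rintro ⟨u, rfl⟩
    refine ⟨(↑u⁻¹ : RatMap).fn, ?_⟩
    rw [← comp_fn, ← mul_def, Units.inv_mul]
    rfl
  · rintro ⟨g, hg⟩
    have hgc : ¬ ∃ c : ℂ, g = RatFunc.C c := by
      rintro ⟨c, rfl⟩
      rw [subst_C] at hg
      exact ident.nonconst ⟨c, hg.symm⟩
    have h1 : (⟨g, hgc⟩ : RatMap) * f = 1 := RatMap.ext ((comp_fn _ f).trans hg)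
    have h2 : f * ⟨g, hgc⟩ = 1 := mul_right_cancel (h := f) (by
      rw [mul_assoc, h1, mul_one, one_mul])
    exact ⟨⟨f, ⟨g, hgc⟩, h2, h1⟩, rfl⟩

/-- `A` is indecomposable: it is not a composition of two rational functions of degree at
least two. -/
def Indecomposable (A : RatMap) : Prop :=
  ¬ ∃ U V : RatMap, 2 ≤ U.degree ∧ 2 ≤ V.degree ∧ A = U * V

end RatMap

/-- The group `Aut(ℂℙ¹)` of Möbius transformations: the rational functions that are invertible
under composition, equivalently those of degree one (`RatMap.isUnit_iff_degree_eq_one`). -/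
abbrev Moebius : Type := RatMapˣ

namespace RatMap

/-- `Σ(A)`: the Möbius transformations `σ` with `A ∘ σ = A`. -/
def symSigma (A : RatMap) : Subgroup Moebius where
  carrier := {σ | A * (σ : RatMap) = A}
  one_mem' := by simp
  mul_mem' := by
    intro σ τ hσ hτ
    simp only [Set.mem_ofPred_eq, Units.val_mul] at *
    rw [← mul_assoc, hσ, hτ]
  inv_mem' := by
    intro σ hσ
    simp only [Set.mem_ofPred_eq] at *
    rw [Units.mul_inv_eq_iff_eq_mul, hσ]

/-- `Aut(A)`: the Möbius transformations `σ` with `A ∘ σ = σ ∘ A`. -/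
def symAut (A : RatMap) : Subgroup Moebius where
  carrier := {σ | A * (σ : RatMap) = σ * A}
  one_mem' := by simp
  mul_mem' := by
    intro σ τ hσ hτ
    simp only [Set.mem_ofPred_eq, Units.val_mul] at *
    rw [← mul_assoc, hσ, mul_assoc, hτ, mul_assoc]
  inv_mem' := by
    intro σ hσ
    simp only [Set.mem_ofPred_eq] at *
    rw [Units.mul_inv_eq_iff_eq_mul, mul_assoc, hσ, Units.inv_mul_cancel_left]

theorem mul_inv_of_semiconj {A : RatMap} {σ ν : Moebius} (h : A * (σ : RatMap) = ν * A) :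
    A * ((σ⁻¹ : Moebius) : RatMap) = (ν⁻¹ : Moebius) * A := by
  rw [Units.mul_inv_eq_iff_eq_mul, mul_assoc, h, Units.inv_mul_cancel_left]

theorem mul_mul_of_semiconj {A : RatMap} {σ τ ν μ : Moebius} (h : A * (σ : RatMap) = ν * A)
    (h' : A * (τ : RatMap) = μ * A) :
    A * ((σ * τ : Moebius) : RatMap) = (ν * μ : Moebius) * A := by
  rw [Units.val_mul, Units.val_mul, ← mul_assoc, h, mul_assoc, h', mul_assoc]

/-- `G(A)`: the Möbius transformations `σ` with `A ∘ σ = ν ∘ A` for some Möbius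
transformation `ν`. -/
def symG (A : RatMap) : Subgroup Moebius where
  carrier := {σ | ∃ ν : Moebius, A * (σ : RatMap) = ν * A}
  one_mem' := ⟨1, by simp⟩
  mul_mem' := by
    rintro σ τ ⟨ν, hν⟩ ⟨μ, hμ⟩
    exact ⟨ν * μ, mul_mul_of_semiconj hν hμ⟩
  inv_mem' := by
    rintro σ ⟨ν, hν⟩
    exact ⟨ν⁻¹, mul_inv_of_semiconj hν⟩

/-- The homomorphism `γ_A : G(A) → Aut(ℂℙ¹)`, which sends `σ` to the unique `ν` with
`A ∘ σ = ν ∘ A`. -/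
noncomputable def gam (A : RatMap) : A.symG →* Moebius where
  toFun σ := σ.2.choose
  map_one' := Units.ext <| mul_right_cancel (h := A) <|
    ((1 : A.symG).2.choose_spec).symm.trans (by simp)
  map_mul' σ τ := Units.ext <| mul_right_cancel (h := A) <|
    ((σ * τ).2.choose_spec).symm.trans
      (mul_mul_of_semiconj σ.2.choose_spec τ.2.choose_spec)

/-- `Ĝ(A)`: the image of `γ_A`. -/
noncomputable def symGHat (A : RatMap) : Subgroup Moebius := A.gam.range

theorem symSigma_pow_mono (A : RatMap) {k l : ℕ} (h : k ≤ l) :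
    (A ^ k).symSigma ≤ (A ^ l).symSigma := by
  intro σ (hσ : A ^ k * (σ : RatMap) = A ^ k)
  change A ^ l * (σ : RatMap) = A ^ l
  rw [← Nat.sub_add_cancel h, pow_add, mul_assoc, hσ]

/-- `Σ_∞(A)`: the union of the groups `Σ(A^{∘k})` over `k ≥ 1`. -/
def symSigmaInf (A : RatMap) : Subgroup Moebius where
  carrier := {σ | ∃ k : ℕ, 1 ≤ k ∧ σ ∈ (A ^ k).symSigma}
  one_mem' := ⟨1, le_rfl, one_mem _⟩
  mul_mem' := by
    rintro σ τ ⟨k, hk, hσ⟩ ⟨l, -, hτ⟩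
    exact ⟨max k l, hk.trans (le_max_left k l),
      mul_mem (A.symSigma_pow_mono (le_max_left k l) hσ)
        (A.symSigma_pow_mono (le_max_right k l) hτ)⟩
  inv_mem' := by
    rintro σ ⟨k, hk, hσ⟩
    exact ⟨k, hk, inv_mem hσ⟩

end RatMap

namespace RatMap

open Polynomial

/-! By Lüroth, indecomposability of `A` means that no field lies strictly between ℂ(A) and ℂ(z).
Each hypothesis forces Σ(A) to be trivial, and then so is Σ_∞(A).

Trivial Σ(A) lets the outer `A` be cancelled in A∘Y = A∘A^m
(`Indecomposable.eq_pow_of_mul_eq_pow_succ`): by a degree count, Y = A^m or Y ∈ ℂ(A)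
(`Indecomposable.eq_or_mem_adjoin`), and in the second case an `A` cancels on the right.

For trivial Ĝ(A), suppose 1 ≠ σ ∈ Σ(A). The field of σ-invariants is then ℂ(A), so everything
commuting with σ lies in G(A) = Σ(A). But centralizers are infinite (`infinite_setOf_commute`) and
Σ(A) is finite. -/

/-! ### Subfields of ℂ(z) and right composition factors. -/

theorem exists_mul_eq_of_mem_adjoin {f g : RatMap} (h : f.fn ∈ ℂ⟮g.fn⟯) :
    ∃ u : RatMap, f = u * g := by
  obtain ⟨r, hr⟩ := (mem_adjoin_iff g f.fn).mp h
  have hrc : ¬ ∃ c : ℂ, r = RatFunc.C c := by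
    rintro ⟨c, rfl⟩
    exact f.nonconst ⟨c, by rw [← hr, subst_C]⟩
  exact ⟨⟨r, hrc⟩, RatMap.ext (by rw [mul_def, comp_fn, hr])⟩

theorem fn_mul_mem_adjoin (f g : RatMap) : (f * g).fn ∈ ℂ⟮g.fn⟯ :=
  (mem_adjoin_iff g _).mpr ⟨f.fn, (comp_fn f g).symm⟩

theorem one_fn : (1 : RatMap).fn = RatFunc.X := rfl

theorem one_le_degree (f : RatMap) : 1 ≤ f.degree := by
  by_contra h
  have h0 : max f.fn.num.natDegree f.fn.denom.natDegree = 0 := by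
    change f.degree = 0
    omega
  rw [Nat.max_eq_zero_iff] at h0
  exact f.nonconst ((RatFunc.eq_C_iff f.fn).mpr h0)

theorem isUnit_of_degree_lt_two {f : RatMap} (h : f.degree < 2) : IsUnit f :=
  (isUnit_iff_degree_eq_one f).mpr (by have := f.one_le_degree; omega)

theorem adjoin_mul_of_isUnit_left {u : RatMap} (hu : IsUnit u) (f : RatMap) :
    ℂ⟮(u * f).fn⟯ = ℂ⟮f.fn⟯ := by
  obtain ⟨u, rfl⟩ := hu
  apply le_antisymm <;> rw [IntermediateField.adjoin_simple_le_iff]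
  · exact fn_mul_mem_adjoin _ _
  · simpa using fn_mul_mem_adjoin ((u⁻¹ : Moebius) : RatMap) ((u : RatMap) * f)

theorem adjoin_of_isUnit {u : RatMap} (hu : IsUnit u) : ℂ⟮u.fn⟯ = ⊤ := by
  simpa [one_fn, RatFunc.adjoin_X] using adjoin_mul_of_isUnit_left hu 1

theorem finrank_adjoin (f : RatMap) : Module.finrank ℂ⟮f.fn⟯ (RatFunc ℂ) = f.degree :=
  RatFunc.finrank_eq_max_natDegree f.fn

/-- An indecomposable function generates a maximal proper subfield of `ℂ(z)`. -/
theorem Indecomposable.eq_adjoin_or_eq_top {A : RatMap} (hA : A.Indecomposable)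
    {F : IntermediateField ℂ (RatFunc ℂ)} (hF : A.fn ∈ F) : F = ℂ⟮A.fn⟯ ∨ F = ⊤ := by
  have hbot : F ≠ ⊥ := by
    rintro rfl
    obtain ⟨c, hc⟩ := IntermediateField.mem_bot.mp hF
    exact A.nonconst ⟨c, by rw [← hc, RatFunc.algebraMap_eq_C]⟩
  -- Lüroth's theorem turns intermediate fields into right factors of `A`.
  obtain ⟨V, rfl⟩ : ∃ V : RatMap, F = ℂ⟮V.fn⟯ :=
    ⟨⟨RatFunc.Luroth.generator F, RatFunc.Luroth.generator_ne_C hbot⟩,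
      RatFunc.Luroth.eq_adjoin_generator⟩
  obtain ⟨U, rfl⟩ := exists_mul_eq_of_mem_adjoin hF
  by_cases hV : V.degree < 2
  · exact Or.inr (adjoin_of_isUnit (isUnit_of_degree_lt_two hV))
  · have hU : U.degree < 2 := by
      by_contra hU
      exact hA ⟨U, V, not_lt.mp hU, not_lt.mp hV, rfl⟩
    exact Or.inl (adjoin_mul_of_isUnit_left (isUnit_of_degree_lt_two hU) V).symm

/-! ### The fiber polynomial and the degree count. -/

/-- For `A = p / q` in lowest terms, the polynomial `p - w q`, whose roots are the
solutions of `A(y) = w`. -/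
noncomputable def fiberPoly (A : RatMap) {K : IntermediateField ℂ (RatFunc ℂ)} (w : K) : K[X] :=
  A.fn.num.map (algebraMap ℂ K) - C w * A.fn.denom.map (algebraMap ℂ K)

section fiberPoly

variable (A : RatMap) {K : IntermediateField ℂ (RatFunc ℂ)}

theorem natDegree_fiberPoly_le (w : K) : (A.fiberPoly w).natDegree ≤ A.degree := by
  refine (natDegree_sub_le _ _).trans (max_le_max ?_ ?_)
  · exact natDegree_map_le
  · exact (natDegree_C_mul_le _ _).trans natDegree_map_le

theorem fiberPoly_ne_zero {w : K} (hw : ¬ ∃ c : ℂ, (w : RatFunc ℂ) = RatFunc.C c) :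
    A.fiberPoly w ≠ 0 := by
  intro h
  have hd : A.fn.denom.leadingCoeff ≠ 0 := leadingCoeff_ne_zero.mpr A.fn.denom_ne_zero
  -- At the degree of q, the vanishing coefficient makes w a quotient of two complex numbers.
  have hc := congrArg (fun p : K[X] => (p.coeff A.fn.denom.natDegree : RatFunc ℂ)) h
  simp only [fiberPoly, coeff_sub, coeff_map, coeff_C_mul, coeff_zero, coeff_natDegree] at hc
  push_cast at hc
  set a := A.fn.num.coeff A.fn.denom.natDegree
  set b := A.fn.denom.leadingCoeff
  rw [RatFunc.algebraMap_eq_C] at hc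
  have hb : RatFunc.C b ≠ 0 := by simpa using hd
  exact hw ⟨a / b, by rw [map_div₀, eq_div_iff hb]; linear_combination -hc⟩

theorem aeval_fiberPoly {w : K} {Y : RatMap} (h : (A * Y).fn = w) :
    aeval Y.fn (A.fiberPoly w) = 0 := by
  have hd : aeval Y.fn A.fn.denom ≠ 0 := fun h0 =>
    A.fn.denom_ne_zero ((transcendental_iff.mp Y.transcendental) _ h0)
  have h' : aeval Y.fn A.fn.num / aeval Y.fn A.fn.denom = w := h
  rw [div_eq_iff hd] at h'
  simp only [fiberPoly, map_sub, map_mul, aeval_map_algebraMap, aeval_C]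
  rw [h']
  exact sub_self _

end fiberPoly

/-- The fiber polynomial over ℂ(A) has degree at most deg A and the root B in ℂ(A). A root Y ≠ B is
a root of the cofactor, so has degree below deg A over ℂ(A); if Y were outside ℂ(A), it would
generate ℂ(z), of degree exactly deg A. -/
theorem Indecomposable.eq_or_mem_adjoin {A Y B : RatMap} (hA : A.Indecomposable)
    (hB : B.fn ∈ ℂ⟮A.fn⟯) (h : A * Y = A * B) : Y = B ∨ Y.fn ∈ ℂ⟮A.fn⟯ := by
  by_contra! hY
  obtain ⟨hne, hmem⟩ := hY
  have hAB : (A * B).fn ∈ ℂ⟮A.fn⟯ := by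
    obtain ⟨R, rfl⟩ := exists_mul_eq_of_mem_adjoin hB
    rw [← mul_assoc]
    exact fn_mul_mem_adjoin _ _
  set P := A.fiberPoly (⟨_, hAB⟩ : ℂ⟮A.fn⟯)
  have hP : P ≠ 0 := A.fiberPoly_ne_zero (A * B).nonconst
  have hPY : aeval Y.fn P = 0 := A.aeval_fiberPoly (congrArg fn h)
  have hPB : aeval B.fn P = 0 := A.aeval_fiberPoly rfl
  have hroot : P.IsRoot ⟨B.fn, hB⟩ := by
    have h0 := aeval_algebraMap_apply_eq_algebraMap_eval (A := RatFunc ℂ) ⟨B.fn, hB⟩ P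
    exact Subtype.ext (h0.symm.trans hPB)
  obtain ⟨Q, hQ⟩ := dvd_iff_isRoot.mpr hroot
  have hQ0 : Q ≠ 0 := by
    rintro rfl
    exact hP (by simpa using hQ)
  have hQY : aeval Y.fn Q = 0 := by
    rw [hQ, map_mul, map_sub, aeval_X, aeval_C] at hPY
    refine (mul_eq_zero.mp hPY).resolve_left fun h0 => hne (RatMap.ext (sub_eq_zero.mp h0))
  have hdeg : Q.natDegree + 1 ≤ A.degree := by
    refine le_trans ?_ (A.natDegree_fiberPoly_le (⟨_, hAB⟩ : ℂ⟮A.fn⟯))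
    change _ ≤ P.natDegree
    rw [hQ, natDegree_mul (X_sub_C_ne_zero _) hQ0, natDegree_X_sub_C, add_comm]
  have htop : (ℂ⟮A.fn⟯)⟮Y.fn⟯ = ⊤ := by
    have hr := hA.eq_adjoin_or_eq_top (F := ((ℂ⟮A.fn⟯)⟮Y.fn⟯).restrictScalars ℂ)
      (((ℂ⟮A.fn⟯)⟮Y.fn⟯).algebraMap_mem ⟨A.fn, IntermediateField.mem_adjoin_simple_self ℂ A.fn⟩)
    rcases hr with hr | hr
    · exact absurd (hr ▸ IntermediateField.mem_adjoin_simple_self (ℂ⟮A.fn⟯) Y.fn :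
        Y.fn ∈ ℂ⟮A.fn⟯) hmem
    · exact IntermediateField.restrictScalars_eq_top_iff.mp hr
  have hint : IsIntegral ℂ⟮A.fn⟯ Y.fn := IsAlgebraic.isIntegral ⟨Q, hQ0, hQY⟩
  have hfin := IntermediateField.adjoin.finrank hint
  rw [htop, IntermediateField.finrank_top', finrank_adjoin] at hfin
  have := natDegree_le_of_dvd (minpoly.dvd _ _ hQY) hQ0
  omega

/-! ### Left cancellation in iterates. -/

theorem isUnit_of_mul_eq_one {f g : RatMap} (h : f * g = 1) : IsUnit f :=
  ⟨⟨f, g, h, mul_right_cancel (h := g * f) (by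
    rw [one_mul, mul_assoc, ← mul_assoc f, h, one_mul])⟩, rfl⟩

theorem Indecomposable.isUnit_of_mul_eq_self {A Y : RatMap} (hA : A.Indecomposable)
    (hdeg : 2 ≤ A.degree) (h : A * Y = A) : IsUnit Y := by
  rcases hA.eq_adjoin_or_eq_top (h ▸ fn_mul_mem_adjoin A Y : A.fn ∈ ℂ⟮Y.fn⟯) with hY | hY
  -- If ℂ(Y) = ℂ(A), then Y = u∘A, and cancelling `A` on the right makes `A` invertible.
  · obtain ⟨u, rfl⟩ := exists_mul_eq_of_mem_adjoin
      (hY ▸ IntermediateField.mem_adjoin_simple_self ℂ Y.fn : Y.fn ∈ ℂ⟮A.fn⟯)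
    have hu : A * u = 1 := mul_right_cancel (h := A) (by rw [mul_assoc, h, one_mul])
    have := (isUnit_iff_degree_eq_one A).mp (isUnit_of_mul_eq_one hu)
    omega
  · rw [isUnit_iff_degree_eq_one, ← finrank_adjoin, hY, IntermediateField.finrank_top]

theorem Indecomposable.eq_pow_of_mul_eq_pow_succ {A : RatMap} (hA : A.Indecomposable)
    (hdeg : 2 ≤ A.degree) (hS : A.symSigma = ⊥) (m : ℕ) {Y : RatMap}
    (h : A * Y = A ^ (m + 1)) : Y = A ^ m := by
  induction m generalizing Y with
  | zero =>
    rw [zero_add, pow_one] at h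
    obtain ⟨σ, rfl⟩ := hA.isUnit_of_mul_eq_self hdeg h
    have hσ : σ ∈ A.symSigma := h
    rw [hS, Subgroup.mem_bot] at hσ
    simp [hσ]
  | succ m ih =>
    have hmem : (A ^ (m + 1)).fn ∈ ℂ⟮A.fn⟯ := by
      rw [pow_succ]
      exact fn_mul_mem_adjoin _ _
    rcases hA.eq_or_mem_adjoin hmem (h.trans (pow_succ' A _)) with hY | hY
    · exact hY
    · obtain ⟨R, rfl⟩ := exists_mul_eq_of_mem_adjoin hY
      have hR : A * R = A ^ (m + 1) := mul_right_cancel (h := A) (by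
        rw [mul_assoc, h, pow_succ])
      rw [ih hR, pow_succ]

theorem Indecomposable.symSigmaInf_eq_bot {A : RatMap} (hA : A.Indecomposable)
    (hdeg : 2 ≤ A.degree) (hS : A.symSigma = ⊥) : A.symSigmaInf = ⊥ := by
  rw [eq_bot_iff]
  rintro σ ⟨k, -, hσ : A ^ k * (σ : RatMap) = A ^ k⟩
  rw [Subgroup.mem_bot]
  induction k with
  | zero => simpa using hσ
  | succ k ih =>
    refine ih (hA.eq_pow_of_mul_eq_pow_succ hdeg hS k ?_)
    -- The outermost `A` is stripped with Y = A^k∘σ.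
    rw [← mul_assoc, ← pow_succ', hσ]

/-! ### Finiteness of Σ(A), and centralizers of its elements. -/

theorem finite_setOf_mul_eq_self (A : RatMap) : {Y : RatMap | A * Y = A}.Finite := by
  set P := A.fiberPoly (⟨A.fn, trivial⟩ : (⊤ : IntermediateField ℂ (RatFunc ℂ)))
  have hP : P ≠ 0 := A.fiberPoly_ne_zero A.nonconst
  refine Set.Finite.of_finite_image (f := fn) ?_ fun _ _ _ _ h => RatMap.ext h
  refine (P.rootSet_finite (RatFunc ℂ)).subset ?_
  rintro _ ⟨Y, hY, rfl⟩
  exact (mem_rootSet_of_ne hP).mpr (A.aeval_fiberPoly (congrArg fn hY))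

/-- The rational functions invariant under `σ`. -/
noncomputable def invariantField (σ : RatMap) : IntermediateField ℂ (RatFunc ℂ) :=
  (AlgHom.equalizer σ.subst (AlgHom.id ℂ _)).toIntermediateField fun x hx => by
    rw [AlgHom.mem_equalizer] at hx ⊢
    rw [map_inv₀, map_inv₀, hx]

theorem mem_invariantField {σ : RatMap} {f : RatFunc ℂ} :
    f ∈ σ.invariantField ↔ σ.subst f = f := Iff.rfl

theorem fn_mem_invariantField {σ f : RatMap} : f.fn ∈ σ.invariantField ↔ f * σ = f := by
  rw [mem_invariantField, ← comp_fn, ← mul_def, RatMap.ext_iff]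

/-- The σ-invariant functions form a proper field containing `A`, hence ℂ(A); since τ commutes with
σ, A∘τ is again invariant. -/
theorem Indecomposable.exists_mul_eq_mul_of_commute {A σ τ : RatMap} (hA : A.Indecomposable)
    (hσ : A * σ = A) (hσ1 : σ ≠ 1) (hc : Commute σ τ) : ∃ ν : RatMap, A * τ = ν * A := by
  have hF : σ.invariantField = ℂ⟮A.fn⟯ := by
    refine (hA.eq_adjoin_or_eq_top (fn_mem_invariantField.mpr hσ)).resolve_right fun htop => ?_
    have h1 : (1 : RatMap).fn ∈ σ.invariantField := htop ▸ trivial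
    exact hσ1 (by simpa using fn_mem_invariantField.mp h1)
  apply exists_mul_eq_of_mem_adjoin
  rw [← hF, fn_mem_invariantField, mul_assoc, ← hc.eq, ← mul_assoc, hσ]

theorem Indecomposable.mem_symG_of_commute {A : RatMap} {σ τ : Moebius} (hA : A.Indecomposable)
    (hσ : σ ∈ A.symSigma) (hσ1 : σ ≠ 1) (hc : Commute σ τ) : τ ∈ A.symG := by
  have h1 : (σ : RatMap) ≠ 1 := by simpa using hσ1
  obtain ⟨ν, hν⟩ := hA.exists_mul_eq_mul_of_commute hσ h1 (hc.map (Units.coeHom RatMap))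
  -- The same for τ⁻¹ supplies an inverse of ν.
  obtain ⟨μ, hμ⟩ := hA.exists_mul_eq_mul_of_commute hσ h1 (hc.inv_right.map (Units.coeHom RatMap))
  simp only [Units.coeHom_apply] at hν hμ
  have hνμ : ν * μ = 1 := mul_right_cancel (h := A) (by
    rw [mul_assoc, ← hμ, ← mul_assoc, ← hν, Units.mul_inv_cancel_right, one_mul])
  obtain ⟨ν, rfl⟩ := isUnit_of_mul_eq_one hνμ
  exact ⟨ν, hν⟩

theorem symG_le_symSigma_of_symGHat_eq_bot {A : RatMap} (h : A.symGHat = ⊥) :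
    A.symG ≤ A.symSigma := by
  intro σ hσ
  have h1 : A.gam ⟨σ, hσ⟩ = 1 := Subgroup.mem_bot.mp (h ▸ ⟨_, rfl⟩)
  have h2 : A * (σ : RatMap) = (A.gam ⟨σ, hσ⟩ : Moebius) * A := hσ.choose_spec
  rw [h1, Units.val_one, one_mul] at h2
  exact h2

theorem symSigma_le_symG (A : RatMap) : A.symSigma ≤ A.symG := by
  intro σ (hσ : A * (σ : RatMap) = A)
  exact ⟨1, by rw [hσ, Units.val_one, one_mul]⟩

/-! ### Linear fractions and infinite centralizers. -/

theorem algebraMap_linear (a b : ℂ) :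
    algebraMap ℂ[X] (RatFunc ℂ) (C a * X + C b) = RatFunc.C a * RatFunc.X + RatFunc.C b := by
  simp

/-- A fraction of linear polynomials with nonzero determinant is a Möbius transformation. -/
theorem exists_moebius {a b c d : ℂ} (h : a * d ≠ b * c) :
    RatFunc.C c * RatFunc.X + RatFunc.C d ≠ 0 ∧ ∃ τ : Moebius,
      (τ : RatMap).fn * (RatFunc.C c * RatFunc.X + RatFunc.C d) =
        RatFunc.C a * RatFunc.X + RatFunc.C b := by
  have hq : C c * X + C d ≠ 0 := by
    intro h0
    have hc := congrArg (coeff · 1) h0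
    have hd := congrArg (coeff · 0) h0
    simp at hc hd
    simp [hc, hd] at h
  have hq' : RatFunc.C c * RatFunc.X + RatFunc.C d ≠ 0 := by
    rw [← algebraMap_linear]
    exact RatFunc.algebraMap_ne_zero hq
  refine ⟨hq', ?_⟩
  set f : RatFunc ℂ := algebraMap ℂ[X] _ (C a * X + C b) / algebraMap ℂ[X] _ (C c * X + C d)
    with hf
  have hfe : f * (RatFunc.C c * RatFunc.X + RatFunc.C d) =
      RatFunc.C a * RatFunc.X + RatFunc.C b := by
    rw [hf, algebraMap_linear, algebraMap_linear, div_mul_cancel₀ _ hq']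
  have hnc : ¬ ∃ k : ℂ, f = RatFunc.C k := by
    rintro ⟨k, hk⟩
    rw [hk, ← algebraMap_linear, ← algebraMap_linear, ← RatFunc.algebraMap_C, ← map_mul] at hfe
    have hp := RatFunc.algebraMap_injective ℂ hfe
    have h1 := congrArg (coeff · 1) hp
    have h0 := congrArg (coeff · 0) hp
    simp at h0 h1
    apply h
    rw [← h0, ← h1]
    ring
  have hp : C a * X + C b ≠ 0 := by
    intro h0
    refine hnc ⟨0, ?_⟩
    rw [hf, h0]
    simp
  have hdeg : (⟨f, hnc⟩ : RatMap).degree < 2 := by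
    refine Nat.lt_succ_of_le (max_le ?_ ?_)
    · exact (natDegree_le_of_dvd (RatFunc.num_div_dvd _ hq) hp).trans natDegree_linear_le
    · exact (natDegree_le_of_dvd (RatFunc.denom_div_dvd _ _) hq).trans natDegree_linear_le
  obtain ⟨τ, hτ⟩ := isUnit_of_degree_lt_two hdeg
  exact ⟨τ, by rw [hτ]; exact hfe⟩

theorem exists_linear_of_moebius (σ : Moebius) : ∃ a b c d : ℂ,
    RatFunc.C c * RatFunc.X + RatFunc.C d ≠ 0 ∧
      (σ : RatMap).fn * (RatFunc.C c * RatFunc.X + RatFunc.C d) =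
        RatFunc.C a * RatFunc.X + RatFunc.C b := by
  have hdeg : max (σ : RatMap).fn.num.natDegree (σ : RatMap).fn.denom.natDegree = 1 :=
    (isUnit_iff_degree_eq_one σ).mp σ.isUnit
  obtain ⟨a, b, hab⟩ := exists_eq_X_add_C_of_natDegree_le_one (hdeg ▸ le_max_left _ _ :
    (σ : RatMap).fn.num.natDegree ≤ 1)
  obtain ⟨c, d, hcd⟩ := exists_eq_X_add_C_of_natDegree_le_one (hdeg ▸ le_max_right _ _ :
    (σ : RatMap).fn.denom.natDegree ≤ 1)
  have hne : RatFunc.C c * RatFunc.X + RatFunc.C d ≠ 0 := by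
    rw [← algebraMap_linear, ← hcd]
    exact RatFunc.algebraMap_ne_zero (RatFunc.denom_ne_zero _)
  refine ⟨a, b, c, d, hne, ?_⟩
  rw [← eq_div_iff hne, ← algebraMap_linear, ← algebraMap_linear, ← hab, ← hcd,
    RatFunc.num_div_denom]

/-- Linear fractional transformations with matrices `M` and `M + t` commute, with denominators
cleared. -/
theorem linear_fractional_commute {K : Type*} [Field K] {a b c d t x s r : K}
    (hs0 : c * x + d ≠ 0) (hr0 : c * x + (d + t) ≠ 0) (hs : s * (c * x + d) = a * x + b)
    (hr : r * (c * x + (d + t)) = (a + t) * x + b) :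
    (a * r + b) * (c * s + (d + t)) = ((a + t) * s + b) * (c * r + d) := by
  refine mul_right_cancel₀ (mul_ne_zero hs0 hr0) ?_
  linear_combination
    (c * x + (d + t)) * (b * c - a * d - t * d - t * c * r) * hs +
    ((a * d + a * t - b * c) * (c * x + d) - t * c * (a * x + b)) * hr

/-- The centralizer of a nontrivial Möbius transformation is infinite: with a matrix `M` of `σ`,
it contains the transformations with matrices `M + t`. -/
theorem infinite_setOf_commute {σ : Moebius} (hσ : σ ≠ 1) :
    {τ : Moebius | Commute σ τ}.Infinite := by
  obtain ⟨a, b, c, d, hs0, hs⟩ := exists_linear_of_moebius σ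
  have hinf : {t : ℂ | (a + t) * (d + t) ≠ b * c}.Infinite := by
    -- P(t) = det(M + t), which vanishes for finitely many t only.
    set P : ℂ[X] := X ^ 2 + C (a + d) * X + C (a * d - b * c) with hPdef
    have hP : P ≠ 0 := by
      intro h0
      have := congrArg (coeff · 2) h0
      simp [hPdef] at this
    refine (rootSet_finite P ℂ).infinite_compl.mono ?_
    intro t ht h
    refine ht ((mem_rootSet_of_ne hP).mpr ?_)
    simp only [hPdef, map_add, map_mul, map_pow, map_sub, aeval_X, aeval_C, Algebra.algebraMap_self,
      RingHom.id_apply]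
    linear_combination h
  choose! τ hτ using fun (t : ℂ) (ht : (a + t) * (d + t) ≠ b * c) => (exists_moebius ht).2
  refine (hinf.image (f := τ) ?_).mono ?_
  -- Injectivity in t: if t ≠ t' gave the same τ, subtracting the two relations would give τ = z,
  -- and then σ = z.
  · intro t ht t' ht' htt
    by_contra hne
    have e := hτ t ht
    have e' := hτ t' ht'
    rw [← htt] at e'
    simp only [map_add] at e e'
    have hX : ((τ t : RatMap)).fn = RatFunc.X := by
      have h0 : RatFunc.C t - RatFunc.C t' ≠ 0 :=
        sub_ne_zero.mpr fun h => hne (RatFunc.C_injective h)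
      refine mul_right_cancel₀ h0 ?_
      linear_combination e - e'
    refine hσ (Units.ext (RatMap.ext (mul_right_cancel₀ hs0 ?_)))
    rw [Units.val_one, one_fn, hs]
    rw [hX] at e
    linear_combination -e
  · rintro _ ⟨t, ht, rfl⟩
    have hτ0 := (exists_moebius ht).1
    have e := hτ t ht
    have u0 : (τ t : RatMap).subst (RatFunc.C c * RatFunc.X + RatFunc.C d) ≠ 0 :=
      (_root_.map_ne_zero _).mpr hs0
    have v0 : (σ : RatMap).subst (RatFunc.C c * RatFunc.X + RatFunc.C (d + t)) ≠ 0 :=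
      (_root_.map_ne_zero _).mpr hτ0
    have u := congrArg (τ t : RatMap).subst hs
    have v := congrArg (σ : RatMap).subst e
    refine Units.ext (RatMap.ext ?_)
    rw [Units.val_mul, Units.val_mul, mul_def, mul_def, comp_fn, comp_fn]
    simp only [map_add, map_mul, subst_C, subst_X] at u v u0 v0 e hτ0
    refine mul_right_cancel₀ (mul_ne_zero u0 v0) ?_
    have key := linear_fractional_commute hs0 hτ0 hs e
    linear_combination (RatFunc.C c * (σ : RatMap).fn + (RatFunc.C d + RatFunc.C t)) * u
      - (RatFunc.C c * (τ t : RatMap).fn + RatFunc.C d) * v + key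

/-! ### Triviality of Σ(A), and the conclusion. -/

theorem Indecomposable.symSigma_eq_bot_of_symGHat_eq_bot {A : RatMap} (hA : A.Indecomposable)
    (h : A.symGHat = ⊥) : A.symSigma = ⊥ := by
  rw [Subgroup.eq_bot_iff_forall]
  intro σ hσ
  by_contra hσ1
  refine (infinite_setOf_commute hσ1).image (f := Units.val) Units.val_injective.injOn ?_
  refine A.finite_setOf_mul_eq_self.subset ?_
  rintro _ ⟨τ, hτ, rfl⟩
  exact symG_le_symSigma_of_symGHat_eq_bot h (hA.mem_symG_of_commute hσ hσ1 hτ)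

/-- For σ ∈ Σ(A) ⊆ G(A) = Aut(A), A = A∘σ = σ∘A, and `A` cancels on the right. -/
theorem symSigma_eq_bot_of_symG_eq_symAut {A : RatMap} (h : A.symG = A.symAut) :
    A.symSigma = ⊥ := by
  rw [Subgroup.eq_bot_iff_forall]
  intro σ hσ
  have h1 : A * (σ : RatMap) = A := hσ
  have h2 : A * (σ : RatMap) = σ * A := (h ▸ A.symSigma_le_symG hσ : σ ∈ A.symAut)
  exact Units.ext (mul_right_cancel (h := A) (by rw [← h2, h1, Units.val_one, one_mul]))

end RatMap

theorem theorem5p5 (A : RatMap) (hdeg : 2 ≤ A.degree) (hA : A.Indecomposable) :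
    (A.symGHat = ⊥ → A.symSigmaInf = A.symSigma) ∧
    (A.symG = ⊥ → A.symSigmaInf = ⊥) ∧
    (A.symG = A.symAut → A.symSigmaInf = ⊥) := by
  refine ⟨fun h => ?_, fun h => ?_, fun h => ?_⟩
  · have hS := hA.symSigma_eq_bot_of_symGHat_eq_bot h
    rw [hS, hA.symSigmaInf_eq_bot hdeg hS]
  · exact hA.symSigmaInf_eq_bot hdeg (eq_bot_iff.mpr (h ▸ A.symSigma_le_symG))
  · exact hA.symSigmaInf_eq_bot hdeg (RatMap.symSigma_eq_bot_of_symG_eq_symAut h)
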